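/- Consider an episodic Markov decision process with measurable state space $\mathcal S$, measurable action space $\mathcal A$, horizon $T\ge 1$, Markov transition kernel $\mathcal P(\cdot\mid s,a)$ and a fixed initial state distribution. For a policy $\pi$ (a Markov kernel from $\mathcal S$ to $\mathcal A$) let $d_t^\pi$ be the distribution of the state at time $t$ under $\pi$ ($d_1^\pi$ being the initial distribution), and let $d^\pi=\frac1T\sum_{t=1}^T d_t^\pi$. Let $\Pi$ be a class of parametric policies, identified with a nonempty, convex and compact set of parameters in a finite-dimensional real normed space; let $\pi^\star$ be an expert policy (not necessarily in $\Pi$), and let $c(s,\pi;\pi^\star)$ be a supervised learning loss, defined for $s\in\mathcal S$ and $\pi\in\Pi$, such that for all $\pi,\pi'\in\Pi$ the expectation $$f_\pi(\pi')=\mathbb E_{s\sim d^\pi}\left[c(s,\pi';\pi^\star)\right]$$ exists (is finite). Suppose that, for some $\alpha,\beta\in[0,\infty)$, the bifunction $f$ is $(\alpha,\beta)$-regular: $f_\pi(\cdot)$ is differentiable on $\Pi$ for every $\pi\in\Pi$, with gradient $\nabla f_\pi(\pi')$ taken with respect to $\pi'$ and relative to $\Pi$ (if $\Pi$ has empty interior,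 for some choice of these gradients), and for every $\pi\in\Pi$, (1) the function $f_\pi(\cdot)$ is $\alpha$-strongly convex on $\Pi$, and (2) the map $\pi'\mapsto\nabla f_{\pi'}(\pi)$ is $\beta$-Lipschitz on $\Pi$ (gradients being measured in the dual norm). If $\alpha>\beta$, then there exists a unique policy $\widehat\pi\in\Pi$ that is optimal on its own state distribution: $$\mathbb E_{s\sim d^{\widehat\pi}}\left[c(s,\widehat\pi;\pi^\star)\right]=\min_{\pi\in\Pi}\ \mathbb E_{s\sim d^{\widehat\pi}}\left[c(s,\pi;\pi^\star)\right].$$ -/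

import Mathlib

open MeasureTheory ProbabilityTheory Set
open scoped NNReal ENNReal

noncomputable section

/-! ### Continuous online learning -/

/-- An online learning problem whose per-round losses come from a bifunction: whenever the learner
plays `x`, the loss of that round is `f x : E → ℝ`, i.e. `l_n = f (x_n)`. The first argument of `f`
is the query argument and the second one is the decision argument. The decision set is a nonempty,
convex and compact subset of a finite-dimensional normed space (only the values of `f` on the
decision set matter). -/
structure BifunctionProblem (E : Type*) [NormedAddCommGroup E] [NormedSpace ℝ E] where
  /-- the decision set -/
  X : Set E
  nonempty : X.Nonempty
  convex : Convex ℝ X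
  compact : IsCompact X
  /-- the bifunction `f x x'`, with query `x` and decision `x'` -/
  f : E → E → ℝ

namespace BifunctionProblem

variable {E : Type*} [NormedAddCommGroup E] [NormedSpace ℝ E]

/-- `g x x'` is the derivative `∇ f_x(x')` of `f_x` (with respect to the decision argument, relative
to the decision set) at `x'`, for all `x, x'` in the decision set. Gradients are elements of the dual
space, which carries the dual norm. -/
def IsGradient (p : BifunctionProblem E) (g : E → E → (E →L[ℝ] ℝ)) : Prop :=
  ∀ x ∈ p.X, ∀ x' ∈ p.X, HasFDerivWithinAt (p.f x) (g x x') p.X x'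

/-- The problem is a continuous online learning (COL) problem: `∇ f_x(x')` is continuous in the
query `x`, for each decision `x'`. -/
def IsCOL (p : BifunctionProblem E) : Prop :=
  ∃ g : E → E → (E →L[ℝ] ℝ), p.IsGradient g ∧ ∀ x' ∈ p.X, ContinuousOn (fun x => g x x') p.X

/-- The problem is an `(α, β)`-regular COL problem: for every `x` in the decision set, `f_x(·)` is
`α`-strongly convex and `∇ f_·(x)` is `β`-Lipschitz. -/
def IsRegular (p : BifunctionProblem E) (α β : ℝ≥0) : Prop :=
  ∃ g : E → E → (E →L[ℝ] ℝ), p.IsGradient g ∧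
    ∀ x ∈ p.X, StrongConvexOn p.X (α : ℝ) (p.f x) ∧ LipschitzOnWith β (fun y => g y x) p.X

/-- A regular problem is in particular a COL problem. -/
theorem IsRegular.isCOL {p : BifunctionProblem E} {α β : ℝ≥0} (h : p.IsRegular α β) : p.IsCOL := by
  obtain ⟨g, hg, h⟩ := h
  exact ⟨g, hg, fun x hx => (h x hx).2.continuousOn⟩

end BifunctionProblem

/-! ### Episodic Markov decision processes -/

/-- A policy: a measurable map from states to probability distributions over actions. -/
structure Policy (S A : Type*) [MeasurableSpace S] [MeasurableSpace A] where
  kernel : Kernel S A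
  markov : IsMarkovKernel kernel

/-- An episodic Markov decision process with finite horizon. -/
structure EpisodicMDP (S A : Type*) [MeasurableSpace S] [MeasurableSpace A] where
  /-- the horizon `T` -/
  horizon : ℕ
  horizon_pos : 0 < horizon
  /-- the transition dynamics: the law of the next state given the state and the action -/
  transition : Kernel (S × A) S
  transition_markov : IsMarkovKernel transition
  /-- the initial state distribution -/
  init : Measure S
  init_prob : IsProbabilityMeasure init
  /-- the reward -/
  reward : S → A → ℝ

namespace EpisodicMDP

variable {S A : Type*} [MeasurableSpace S] [MeasurableSpace A]

/-- The law of the state after `k` transitions under the policy `π`: draw an action from `π` and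
then the next state from the transition dynamics, `k` times, starting from the initial
distribution. So `M.stateLaw π (t - 1)` is the state distribution `d_t^π` at time `t = 1, …, T`. -/
def stateLaw (M : EpisodicMDP S A) (π : Policy S A) : ℕ → Measure S
  | 0 => M.init
  | k + 1 => (M.stateLaw π k ⊗ₘ π.kernel).bind M.transition

/-- The average state distribution `d^π = (1 / T) ∑_{t = 1}^T d_t^π`. -/
def avgStateLaw (M : EpisodicMDP S A) (π : Policy S A) : Measure S :=
  (M.horizon : ℝ≥0∞)⁻¹ • ∑ k ∈ Finset.range M.horizon, M.stateLaw π k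

theorem isProbabilityMeasure_stateLaw (M : EpisodicMDP S A) (π : Policy S A) (k : ℕ) :
    IsProbabilityMeasure (M.stateLaw π k) := by
  have := π.markov
  have := M.transition_markov
  induction k with
  | zero => exact M.init_prob
  | succ k ih => rw [stateLaw]; infer_instance

theorem isProbabilityMeasure_avgStateLaw (M : EpisodicMDP S A) (π : Policy S A) :
    IsProbabilityMeasure (M.avgStateLaw π) := by
  have := M.isProbabilityMeasure_stateLaw π
  have h0 : (M.horizon : ℝ≥0∞) ≠ 0 := by exact_mod_cast M.horizon_pos.ne'
  constructor
  simp [avgStateLaw, ENNReal.inv_mul_cancel h0 (ENNReal.natCast_ne_top _)]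

end EpisodicMDP

/-! ### Online imitation learning -/

/-- An online imitation learning problem. The policy class is parametric: it consists of the policies
`policy θ` for `θ` in a nonempty, convex and compact set `Π` of parameters, and a policy of the class
is identified with its parameter (values of `policy` and `loss` at parameters outside `Π` play no
role). The supervised learning loss `c(s, π; π⋆)` may depend on the learner's policy in any way,
and its expectation under each state distribution `d^π`, `π ∈ Π`, exists. -/
structure OnlineIL (S A E : Type*) [MeasurableSpace S] [MeasurableSpace A]
    [NormedAddCommGroup E] [NormedSpace ℝ E] where
  mdp : EpisodicMDP S A
  /-- the set `Π` of allowed policies, as a set of parameters -/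
  params : Set E
  params_nonempty : params.Nonempty
  params_convex : Convex ℝ params
  params_compact : IsCompact params
  /-- the policy with a given parameter -/
  policy : E → Policy S A
  /-- the expert policy `π⋆`, which need not belong to the class -/
  expert : Policy S A
  /-- the supervised learning loss `c(s, π; π⋆)` -/
  loss : S → E → Policy S A → ℝ
  loss_integrable : ∀ θ ∈ params, ∀ θ' ∈ params,
    Integrable (fun s => loss s θ' expert) (mdp.avgStateLaw (policy θ))

namespace OnlineIL

variable {S A E : Type*} [MeasurableSpace S] [MeasurableSpace A]
  [NormedAddCommGroup E] [NormedSpace ℝ E]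

/-- The state distribution `d^π` of the policy with parameter `θ`. -/
def stateDist (I : OnlineIL S A E) (θ : E) : Measure S :=
  I.mdp.avgStateLaw (I.policy θ)

/-- Online imitation learning as an online learning problem: the decision set is the policy class
and the bifunction is `f_π(π') = 𝔼_{s ∼ d^π} [c(s, π'; π⋆)]`. -/
def toProblem (I : OnlineIL S A E) : BifunctionProblem E where
  X := I.params
  nonempty := I.params_nonempty
  convex := I.params_convex
  compact := I.params_compact
  f := fun θ θ' => ∫ s, I.loss s θ' I.expert ∂(I.stateDist θ)

end OnlineIL

end

/-! A policy optimal on its own state distribution is a fixed point of the best-response map sending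
`x` to a minimizer of `f_x`. This map is `β / α`-Lipschitz (`IsRegular.norm_sub_le_of_isMinOn`):
strong convexity makes the gradient of `f_x` strongly monotone, the first-order conditions control
its sign at the two minimizers, and a change of query moves the gradient by at most `β` times the
distance between the queries. For `β < α`, Banach's theorem gives existence, and the same estimate
gives uniqueness. -/

/-- First-order condition for a minimum over a convex set. -/
theorem IsMinOn.hasFDerivWithinAt_sub_nonneg {E : Type*} [NormedAddCommGroup E] [NormedSpace ℝ E]
    {s : Set E} {f : E → ℝ} {f' : E →L[ℝ] ℝ} {x y : E} (hs : Convex ℝ s) (hmin : IsMinOn f s x)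
    (hf : HasFDerivWithinAt f f' s x) (hx : x ∈ s) (hy : y ∈ s) : 0 ≤ f' (y - x) :=
  IsLocalMinOn.hasFDerivWithinAt_nonneg hmin.localize hf
    (sub_mem_posTangentConeAt_of_segment_subset (hs.segment_subset hx hy))

/-- A strongly convex function lies above the quadratic given by its derivative at a point. -/
theorem StrongConvexOn.fderivWithin_add_le_sub {E : Type*} [NormedAddCommGroup E]
    [NormedSpace ℝ E] {s : Set E} {f : E → ℝ} {f' : E →L[ℝ] ℝ} {m : ℝ} {x y : E}
    (hconv : StrongConvexOn s m f) (hf : HasFDerivWithinAt f f' s x) (hx : x ∈ s) (hy : y ∈ s) :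
    f' (y - x) + m / 2 * ‖y - x‖ ^ 2 ≤ f y - f x := by
  have hmaps : MapsTo (AffineMap.lineMap x y : ℝ → E) (Icc 0 1) s := by
    intro t ht
    exact hconv.1.lineMap_mem hx hy ht
  have hline : HasDerivWithinAt (fun t : ℝ => f (AffineMap.lineMap x y t)) (f' (y - x))
      (Icc 0 1) 0 := by
    have h0 : HasFDerivWithinAt f f' s (AffineMap.lineMap x y (0 : ℝ)) := by simpa using hf
    exact h0.comp_hasDerivWithinAt (0 : ℝ) AffineMap.hasDerivWithinAt_lineMap hmaps
  -- This quadratic in `t` is the upper bound that strong convexity puts on `f` along the segment.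
  have hpoly : HasDerivAt (fun t : ℝ => (1 - t) * f x + t * f y
      - (1 - t) * t * (m / 2 * ‖y - x‖ ^ 2)) (f y - f x - m / 2 * ‖y - x‖ ^ 2) 0 := by
    have hid := hasDerivAt_id (0 : ℝ)
    have hone := hid.const_sub 1
    have hsum := ((hone.mul_const (f x)).add (hid.mul_const (f y))).sub
      ((hone.mul hid).mul_const (m / 2 * ‖y - x‖ ^ 2))
    refine hsum.congr_deriv ?_
    simp only [id]
    ring
  have hgap := hpoly.hasDerivWithinAt.sub hline
  -- The gap between bound and function is nonnegative on `[0, 1]` and vanishes at `0`, so its right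
  -- derivative there is nonnegative, which is the claim.
  have hmin : IsMinOn ((fun t : ℝ => (1 - t) * f x + t * f y
      - (1 - t) * t * (m / 2 * ‖y - x‖ ^ 2)) - fun t : ℝ => f (AffineMap.lineMap x y t))
      (Icc 0 1) 0 := by
    intro t ht
    have h := hconv.2 hx hy (sub_nonneg.2 ht.2) ht.1 (sub_add_cancel 1 t)
    rw [← AffineMap.lineMap_apply_module, norm_sub_rev x y] at h
    simp only [smul_eq_mul] at h
    simpa using h
  have := hmin.hasFDerivWithinAt_sub_nonneg (convex_Icc 0 1) hgap.hasFDerivWithinAt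
    (y := 1) (by simp) (by simp)
  have : 0 ≤ f y - f x - m / 2 * ‖y - x‖ ^ 2 - f' (y - x) := by simpa using this
  linarith

namespace BifunctionProblem

variable {E : Type*} [NormedAddCommGroup E] [NormedSpace ℝ E]

theorem IsRegular.exists_isMinOn {p : BifunctionProblem E} {α β : ℝ≥0} (h : p.IsRegular α β)
    {x : E} (hx : x ∈ p.X) : ∃ x' ∈ p.X, IsMinOn (p.f x) p.X x' := by
  obtain ⟨g, hg, -⟩ := h
  exact p.compact.exists_isMinOn p.nonempty fun x' hx' => (hg x hx x' hx').continuousWithinAt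

/-- Minimizers of the losses of a regular problem depend on the query in a Lipschitz way. -/
theorem IsRegular.norm_sub_le_of_isMinOn {p : BifunctionProblem E} {α β : ℝ≥0}
    (h : p.IsRegular α β) {x y u v : E} (hx : x ∈ p.X) (hy : y ∈ p.X) (hu : u ∈ p.X)
    (hv : v ∈ p.X) (hxu : IsMinOn (p.f x) p.X u) (hyv : IsMinOn (p.f y) p.X v) :
    α * ‖u - v‖ ≤ β * ‖x - y‖ := by
  obtain ⟨g, hg, h⟩ := h
  rcases eq_or_ne u v with rfl | huv
  · simp only [sub_self, norm_zero, mul_zero]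
    positivity
  have hpos : 0 < ‖u - v‖ := norm_pos_iff.2 (sub_ne_zero.2 huv)
  -- Both inequalities concern the same `f x`; in their sum the function values cancel and the two
  -- halves of `α` add up.
  have h₁ := (h x hx).1.fderivWithin_add_le_sub (hg x hx u hu) hu hv
  have h₂ := (h x hx).1.fderivWithin_add_le_sub (hg x hx v hv) hv hu
  have h₃ := hxu.hasFDerivWithinAt_sub_nonneg p.convex (hg x hx u hu) hu hv
  have h₄ := hyv.hasFDerivWithinAt_sub_nonneg p.convex (hg y hy v hv) hv hu
  -- The optimality of `v` is for the query `y`, whereas strong convexity was used for `x`; the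
  -- Lipschitz bound at the fixed decision `v` pays for the exchange.
  have h₅ : (g y v - g x v) (u - v) ≤ β * ‖x - y‖ * ‖u - v‖ := by
    refine (le_abs_self _).trans (((g y v - g x v).le_opNorm (u - v)).trans ?_)
    gcongr
    rw [norm_sub_rev x y]
    exact (h v hv).2.norm_sub_le hy hx
  rw [sub_apply] at h₅
  rw [norm_sub_rev v u] at h₁
  refine le_of_mul_le_mul_right ?_ hpos
  nlinarith

/-- If `β < α`, then an `(α, β)`-regular problem has exactly one decision that minimizes the loss
it induces. -/
theorem IsRegular.existsUnique_isMinOn_self {p : BifunctionProblem E} {α β : ℝ≥0}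
    (h : p.IsRegular α β) (hαβ : β < α) : ∃! x, x ∈ p.X ∧ IsMinOn (p.f x) p.X x := by
  have hα : 0 < α := pos_of_gt hαβ
  have hα' : (0 : ℝ) < α := hα
  choose! T hTX hTmin using fun x (hx : x ∈ p.X) => h.exists_isMinOn hx
  -- Compactness supplies the completeness needed by the fixed-point theorem.
  have : CompactSpace p.X := isCompact_iff_compactSpace.1 p.compact
  have : Nonempty p.X := p.nonempty.to_subtype
  have hT : ContractingWith (β / α) (fun x : p.X => (⟨T x, hTX x x.2⟩ : p.X)) := by
    refine ⟨(div_lt_one hα).2 hαβ, LipschitzWith.of_dist_le_mul fun x y => ?_⟩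
    have := h.norm_sub_le_of_isMinOn x.2 y.2 (hTX x x.2) (hTX y y.2) (hTmin x x.2) (hTmin y y.2)
    rw [Subtype.dist_eq, Subtype.dist_eq, dist_eq_norm, dist_eq_norm, NNReal.coe_div,
      div_mul_eq_mul_div, le_div_iff₀ hα', mul_comm]
    exact this
  obtain ⟨⟨x, hx⟩, hfix⟩ : ∃ x : p.X, (⟨T x, hTX x x.2⟩ : p.X) = x :=
    ⟨_, hT.fixedPoint_isFixedPt⟩
  have hxmin := hTmin x hx
  rw [show T x = x from congrArg Subtype.val hfix] at hxmin
  refine ⟨x, ⟨hx, hxmin⟩, ?_⟩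
  rintro y ⟨hy, hymin⟩
  -- Queries and minimizers coincide here, so `α * ‖y - x‖ ≤ β * ‖y - x‖`, which forces `y = x`.
  have := h.norm_sub_le_of_isMinOn hy hx hy hx hymin hxmin
  have hlt : (β : ℝ) < α := hαβ
  refine sub_eq_zero.1 (norm_eq_zero.1 (le_antisymm ?_ (norm_nonneg _)))
  nlinarith [norm_nonneg (y - x)]

end BifunctionProblem

theorem proposition2 {S A E : Type*} [MeasurableSpace S] [MeasurableSpace A]
    [NormedAddCommGroup E] [NormedSpace ℝ E] [FiniteDimensional ℝ E]
    (I : OnlineIL S A E) (α β : ℝ≥0) (hreg : I.toProblem.IsRegular α β) (hαβ : β < α) :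
    ∃! θ : E, θ ∈ I.params ∧
      IsLeast ((fun θ' : E => ∫ s, I.loss s θ' I.expert ∂(I.stateDist θ)) '' I.params)
        (∫ s, I.loss s θ I.expert ∂(I.stateDist θ)) := by
  obtain ⟨θ, ⟨hθ, hmin⟩, huniq⟩ := hreg.existsUnique_isMinOn_self hαβ
  refine ⟨θ, ⟨hθ, mem_image_of_mem _ hθ, forall_mem_image.2 hmin⟩, ?_⟩
  rintro y ⟨hy, hleast⟩
  exact huniq y ⟨hy, fun z hz => hleast.2 (mem_image_of_mem _ hz)⟩
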